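/- Let $n\ge 1$, write $x_1$ for the first coordinate of $x\in\mathbb{R}^n$, and let $\mathbb{R}^n_-=\{x\in\mathbb{R}^n : x_1<0\}$. Let $h\in C^2(\overline{\mathbb{R}^n_-}\setminus\{0\})$ be a real-valued function. Assume that - $h\ge 0$ near $0$, that is, there is $\delta>0$ such that $h(x)\ge 0$ for all $x\in\overline{\mathbb{R}^n_-}\setminus\{0\}$ with $|x|<\delta$; - $h$ is harmonic in $\mathbb{R}^n_-$; - $h=0$ on $\partial\mathbb{R}^n_-\setminus\{0\}$; - there exists $C>0$ such that $|h(x)|\le C|x|^{1-n}$ for all $x\in\mathbb{R}^n_-$. Then there exists $\alpha\ge 0$ such that $$h(x)=\alpha\,\frac{|x_1|}{|x|^n}\qquad\text{for all }x\in\overline{\mathbb{R}^n_-}\setminus\{0\}.$$ -/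

import Mathlib

/-- The open half-space `{x ∈ ℝⁿ | x₁ < 0}`; the first coordinate `x₁` is `x 0`. -/
def negHalfSpace (n : ℕ) [NeZero n] : Set (EuclideanSpace ℝ (Fin n)) :=
  {x | x 0 < 0}

/-! The Kelvin transform H(x) = |x|^(2-n) h(x/|x|²) trades the singularity at 0 for growth at
infinity: H is harmonic in the half-space, vanishes on the boundary hyperplane, and |h| ≤ C|x|^(1-n)
becomes |H| ≤ C|x|. A Liouville theorem (`IsHalfSpaceHarmonic.exists_eq_mul`) then gives H = a x₁.
Undoing the transform yields h = -a|x₁|/|x|ⁿ, and the sign of h near 0 gives -a ≥ 0.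

The Liouville theorem needs only the weak maximum principle and explicit barriers. For e_j parallel
to the boundary, w(x, s) = H(x + s e_j) - H(x - s e_j) solves an elliptic equation in (x, s),
vanishes for s = 0 and for x₁ = 0, and grows at most linearly. A barrier on quarter-balls with R → ∞
gives w ≤ const · s (`sub_le`). For fixed s, w is then harmonic in x and bounded above, so a second
barrier gives w ≤ 0 (`sub_nonpos`). With the same for -H, w = 0. Thus H depends on x₁ alone and has
zero second derivative there. -/

/-- The function `t ↦ f (x + t • v)` is twice differentiable at `0`, with second derivative `c`. -/
def HasLineDeriv2 {V : Type*} [AddCommGroup V] [Module ℝ V] (f : V → ℝ) (x v : V) (c : ℝ) : Prop :=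
  ∃ g : ℝ → ℝ, (∀ᶠ t in nhds (0 : ℝ), HasDerivAt (fun t => f (x + t • v)) (g t) t) ∧
    HasDerivAt g c 0

/-! ### Second derivatives along lines -/

namespace HasLineDeriv2

section
variable {V : Type*} [AddCommGroup V] [Module ℝ V] {f f₁ f₂ : V → ℝ} {x v : V} {c c₁ c₂ : ℝ}

theorem add (h₁ : HasLineDeriv2 f₁ x v c₁) (h₂ : HasLineDeriv2 f₂ x v c₂) :
    HasLineDeriv2 (fun y => f₁ y + f₂ y) x v (c₁ + c₂) := by
  obtain ⟨g₁, hg₁, hc₁⟩ := h₁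
  obtain ⟨g₂, hg₂, hc₂⟩ := h₂
  refine ⟨fun t => g₁ t + g₂ t, ?_, hc₁.add hc₂⟩
  filter_upwards [hg₁, hg₂] with t h1 h2 using h1.add h2

theorem const_mul (a : ℝ) (h : HasLineDeriv2 f x v c) :
    HasLineDeriv2 (fun y => a * f y) x v (a * c) := by
  obtain ⟨g, hg, hc⟩ := h
  refine ⟨fun t => a * g t, ?_, hc.const_mul a⟩
  filter_upwards [hg] with t h1 using h1.const_mul a

theorem neg (h : HasLineDeriv2 f x v c) : HasLineDeriv2 (fun y => -f y) x v (-c) := by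
  simpa using h.const_mul (-1)

theorem sub (h₁ : HasLineDeriv2 f₁ x v c₁) (h₂ : HasLineDeriv2 f₂ x v c₂) :
    HasLineDeriv2 (fun y => f₁ y - f₂ y) x v (c₁ - c₂) := by
  simpa [sub_eq_add_neg] using h₁.add h₂.neg

theorem unique (h₁ : HasLineDeriv2 f x v c₁) (h₂ : HasLineDeriv2 f x v c₂) : c₁ = c₂ := by
  obtain ⟨g₁, hg₁, hc₁⟩ := h₁
  obtain ⟨g₂, hg₂, hc₂⟩ := h₂
  have : g₁ =ᶠ[nhds 0] g₂ := by
    filter_upwards [hg₁, hg₂] with t h1 h2 using h1.unique h2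
  exact hc₁.unique (hc₂.congr_of_eventuallyEq this)

/-- Second derivative of a function that is a quadratic polynomial along the line. -/
theorem of_quadratic {a b : ℝ} (h : ∀ t : ℝ, f (x + t • v) = f x + t * b + t ^ 2 * a) :
    HasLineDeriv2 f x v (2 * a) := by
  refine ⟨fun t => b + 2 * t * a, .of_forall fun t => ?_, ?_⟩
  · simp_rw [h]
    have := ((hasDerivAt_id t).mul_const b).const_add (f x) |>.add
      (((hasDerivAt_id t).pow 2).mul_const a)
    exact this.congr_deriv (by simp)
  · have := (((hasDerivAt_id (0 : ℝ)).const_mul 2).mul_const a).const_add b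
    exact this.congr_deriv (by ring)

theorem of_const (h : ∀ t : ℝ, f (x + t • v) = f x) : HasLineDeriv2 f x v 0 := by
  simpa using of_quadratic (f := f) (x := x) (v := v) (a := 0) (b := 0) (by simpa using h)

/-- Transport along a map that is affine on the line. -/
theorem comp_line {U : Type*} [AddCommGroup U] [Module ℝ U] {u w : U} {φ : U → V} (r : ℝ)
    (h : HasLineDeriv2 f x v c) (hφ : ∀ t : ℝ, φ (u + t • w) = x + (r * t) • v) :
    HasLineDeriv2 (fun y => f (φ y)) u w (r ^ 2 * c) := by
  obtain ⟨g, hg, hc⟩ := h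
  have hl : ∀ t : ℝ, HasDerivAt (fun t : ℝ => r * t) r t := fun t => by
    simpa using (hasDerivAt_id t).const_mul r
  refine ⟨fun t => g (r * t) * r, ?_, ?_⟩
  · have ht : Filter.Tendsto (fun t : ℝ => r * t) (nhds 0) (nhds 0) := by
      simpa using (hl 0).continuousAt.tendsto
    filter_upwards [ht.eventually hg] with t h1
    simp_rw [hφ]
    exact HasDerivAt.comp t (h₂ := fun t => f (x + t • v)) h1 (hl t)
  · have h0 : HasDerivAt g c (r * 0) := by simpa using hc
    exact ((HasDerivAt.comp 0 h0 (hl 0)).mul_const r).congr_deriv (by ring)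

end

section
variable {V : Type*} [NormedAddCommGroup V] [NormedSpace ℝ V] {f f₁ f₂ : V → ℝ} {x v : V} {c : ℝ}

theorem tendsto_line (x v : V) :
    Filter.Tendsto (fun t : ℝ => x + t • v) (nhds 0) (nhds x) := by
  have : Continuous (fun t : ℝ => x + t • v) := by fun_prop
  simpa using this.tendsto 0

theorem congr (h : HasLineDeriv2 f₁ x v c) (he : f₁ =ᶠ[nhds x] f₂) : HasLineDeriv2 f₂ x v c := by
  obtain ⟨g, hg, hc⟩ := h
  refine ⟨g, ?_, hc⟩
  filter_upwards [hg, ((tendsto_line x v).eventually he).eventually_nhds] with t h1 h2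
  exact h1.congr_of_eventuallyEq (h2.mono fun _ hs => hs.symm)

/-- If c > 0, the second derivative test makes the point a local minimum as well, so f is locally
constant on the line and c = 0. -/
theorem nonpos_of_isLocalMax (h : HasLineDeriv2 f x v c) (hm : IsLocalMax f x) : c ≤ 0 := by
  obtain ⟨g, hg, hc⟩ := h
  by_contra! hpos
  set F : ℝ → ℝ := fun t => f (x + t • v) with hF
  have hmax : IsLocalMax F 0 := by
    have := (tendsto_line x v).eventually hm
    filter_upwards [this] with t ht
    simpa [hF] using ht
  have hdF : deriv F =ᶠ[nhds 0] g := by filter_upwards [hg] with t ht using ht.deriv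
  have hd2 : deriv (deriv F) 0 = c := by rw [hdF.deriv_eq, hc.deriv]
  have hmin : IsLocalMin F 0 :=
    isLocalMin_of_deriv_deriv_pos (by rw [hd2]; exact hpos) hmax.deriv_eq_zero
      hg.self_of_nhds.continuousAt
  have hconst : F =ᶠ[nhds 0] fun _ => F 0 := by
    filter_upwards [hmax, hmin] with t h1 h2 using le_antisymm h1 h2
  have h0 : deriv F =ᶠ[nhds 0] fun _ => 0 := by
    have := hconst.deriv
    simpa using this
  have : deriv (deriv F) 0 = 0 := by rw [h0.deriv_eq]; simp
  linarith

end
end HasLineDeriv2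

/-! ### Maximum principle and symmetric differences with the step as a variable -/

/-- Weak maximum principle. -/
theorem nonpos_of_hasLineDeriv2_pos {V : Type*} [NormedAddCommGroup V] [NormedSpace ℝ V]
    {f : V → ℝ} {K : Set V} (hK : IsCompact K) (hf : ContinuousOn f K)
    (h : ∀ p ∈ K, f p ≤ 0 ∨ K ∈ nhds p ∧ ∃ v c, HasLineDeriv2 f p v c ∧ 0 < c) :
    ∀ p ∈ K, f p ≤ 0 := by
  intro p hp
  obtain ⟨q, hq, hmax⟩ := hK.exists_isMaxOn ⟨p, hp⟩ hf
  refine (hmax hp).trans ?_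
  rcases h q hq with h0 | ⟨hn, v, c, hc, hpos⟩
  · exact h0
  · exact absurd (hc.nonpos_of_isLocalMax (hmax.isLocalMax hn)) (not_le.2 hpos)
theorem norm_sq_add_smul_single {n : ℕ} (x : EuclideanSpace ℝ (Fin n)) (j : Fin n) (t : ℝ) :
    ‖x + t • EuclideanSpace.single j (1 : ℝ)‖ ^ 2 = ‖x‖ ^ 2 + t * (2 * x j) + t ^ 2 * 1 := by
  rw [norm_add_sq_real, norm_smul, inner_smul_right, EuclideanSpace.inner_single_right]
  simp
  ring

theorem hasLineDeriv2_cylinder_barrier {n : ℕ} (k R : ℝ) (x : EuclideanSpace ℝ (Fin n)) (s : ℝ)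
    (i : Fin n) (r : ℝ) :
    HasLineDeriv2 (fun p : EuclideanSpace ℝ (Fin n) × ℝ =>
      ‖p.1‖ ^ 2 + p.2 ^ 2 - k * p.2 ^ 2 + k * R * p.2)
      (x, s) (EuclideanSpace.single i 1, r) (2 * (1 + r ^ 2 - k * r ^ 2)) := by
  apply HasLineDeriv2.of_quadratic (b := 2 * x i + 2 * s * r - k * (2 * s * r) + k * R * r)
  intro t
  have := norm_sq_add_smul_single x i t
  simp only [Prod.fst_add, Prod.snd_add, Prod.smul_fst, Prod.smul_snd, this, smul_eq_mul]
  ring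

/-- Second derivatives of `(x, s) ↦ H (x + s • a) - H (x - s • a)`. -/
theorem HasLineDeriv2.symm_diff {V : Type*} [AddCommGroup V] [Module ℝ V] {H : V → ℝ}
    {x a v : V} {s c d : ℝ} (hc : HasLineDeriv2 H (x + s • a) v c)
    (hd : HasLineDeriv2 H (x - s • a) v d) :
    HasLineDeriv2 (fun p : V × ℝ => H (p.1 + p.2 • a) - H (p.1 - p.2 • a)) (x, s) (v, 0)
      (c - d) := by
  have h1 := hc.comp_line (U := V × ℝ) (u := (x, s)) (w := (v, 0))
    (φ := fun p => p.1 + p.2 • a) 1 (fun t => by simp; abel)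
  have h2 := hd.comp_line (U := V × ℝ) (u := (x, s)) (w := (v, 0))
    (φ := fun p => p.1 - p.2 • a) 1 (fun t => by simp; abel)
  simpa using h1.sub h2

/-- Along (a, 1) the point x - s a stays fixed while x + s a moves at double speed, hence the factor
2² = 4 and no contribution from the second term. -/
theorem HasLineDeriv2.symm_diff_left {V : Type*} [AddCommGroup V] [Module ℝ V] {H : V → ℝ}
    {x a : V} {s c : ℝ} (hc : HasLineDeriv2 H (x + s • a) a c) :
    HasLineDeriv2 (fun p : V × ℝ => H (p.1 + p.2 • a) - H (p.1 - p.2 • a)) (x, s) (a, 1)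
      (4 * c) := by
  have h1 := hc.comp_line (U := V × ℝ) (u := (x, s)) (w := (a, 1))
    (φ := fun p => p.1 + p.2 • a) 2 (fun t => by simp; module)
  have h2 : HasLineDeriv2 (fun p : V × ℝ => H (p.1 - p.2 • a)) (x, s) (a, 1) 0 :=
    HasLineDeriv2.of_const fun t => by
      congr 1
      simp only [Prod.fst_add, Prod.snd_add, Prod.smul_fst, Prod.smul_snd, smul_eq_mul]
      module
  have := h1.sub h2
  norm_num at this
  exact this

theorem HasLineDeriv2.symm_diff_right {V : Type*} [AddCommGroup V] [Module ℝ V] {H : V → ℝ}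
    {x a : V} {s d : ℝ} (hd : HasLineDeriv2 H (x - s • a) a d) :
    HasLineDeriv2 (fun p : V × ℝ => H (p.1 + p.2 • a) - H (p.1 - p.2 • a)) (x, s) (a, -1)
      (-(4 * d)) := by
  have h1 := hd.comp_line (U := V × ℝ) (u := (x, s)) (w := (a, -1))
    (φ := fun p => p.1 - p.2 • a) 2 (fun t => by simp; module)
  have h2 : HasLineDeriv2 (fun p : V × ℝ => H (p.1 + p.2 • a)) (x, s) (a, -1) 0 :=
    HasLineDeriv2.of_const fun t => by
      congr 1
      simp only [Prod.fst_add, Prod.snd_add, Prod.smul_fst, Prod.smul_snd, smul_eq_mul]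
      module
  have := h2.sub h1
  norm_num at this
  exact this

/-! ### Liouville theorem in the half-space -/

/-- A continuous function on `ℝⁿ` of at most linear growth that vanishes where `0 ≤ x 0` and
whose second derivatives along the coordinate axes sum to zero where `x 0 < 0`. -/
structure IsHalfSpaceHarmonic {n : ℕ} [NeZero n] (H : EuclideanSpace ℝ (Fin n) → ℝ) (C : ℝ) :
    Prop where
  continuous : Continuous H
  eq_zero : ∀ x, 0 ≤ x 0 → H x = 0
  bound : ∀ x, |H x| ≤ C * ‖x‖
  harmonic : ∀ x, x 0 < 0 → ∃ c : Fin n → ℝ,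
    (∀ i, HasLineDeriv2 H x (EuclideanSpace.single i 1) (c i)) ∧ ∑ i, c i = 0

namespace IsHalfSpaceHarmonic

variable {n : ℕ} [NeZero n] {H : EuclideanSpace ℝ (Fin n) → ℝ} {C : ℝ}

theorem neg (hH : IsHalfSpaceHarmonic H C) : IsHalfSpaceHarmonic (fun x => -H x) C where
  continuous := hH.continuous.neg
  eq_zero x hx := by simp [hH.eq_zero x hx]
  bound x := by simpa using hH.bound x
  harmonic x hx := by
    obtain ⟨c, hc, hs⟩ := hH.harmonic x hx
    exact ⟨fun i => -c i, fun i => (hc i).neg, by simp [hs]⟩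

/-- With k = 2n + 1 the barrier is |x|² + s² + k s(R - s) - s², up to regrouping: it is nonnegative
for 0 ≤ s ≤ R, and at least R² on the sphere, where the difference is at most 2C · 2R = 4CR. This
fixes the factor 4C/R. -/
theorem sub_le_on_ball (hH : IsHalfSpaceHarmonic H C) (hC : 0 < C) {j : Fin n} (hj : j ≠ 0)
    {R : ℝ} (hR : 0 < R) :
    ∀ p ∈ {p : EuclideanSpace ℝ (Fin n) × ℝ | p.1 0 ≤ 0 ∧ 0 ≤ p.2 ∧ ‖p.1‖ ^ 2 + p.2 ^ 2 ≤ R ^ 2},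
      H (p.1 + p.2 • EuclideanSpace.single j 1) - H (p.1 - p.2 • EuclideanSpace.single j 1)
        - 4 * C / R * (‖p.1‖ ^ 2 + p.2 ^ 2 - (2 * n + 1) * p.2 ^ 2 + (2 * n + 1) * R * p.2)
        ≤ 0 := by
  have hM : 0 < 4 * C / R := by positivity
  set M := 4 * C / R with hMdef
  set e : Fin n → EuclideanSpace ℝ (Fin n) := fun i => EuclideanSpace.single i 1 with he
  have hcH := hH.continuous
  have hcoord : Continuous fun x : EuclideanSpace ℝ (Fin n) => x 0 := by fun_prop
  have hcN : Continuous fun p : EuclideanSpace ℝ (Fin n) × ℝ => ‖p.1‖ ^ 2 + p.2 ^ 2 := by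
    fun_prop
  have hej : e j 0 = 0 := by simp [he, hj.symm]
  apply nonpos_of_hasLineDeriv2_pos
  · apply Metric.isCompact_of_isClosed_isBounded
    · refine (isClosed_le (hcoord.comp continuous_fst) continuous_const).inter
        ((isClosed_le continuous_const continuous_snd).inter
          (isClosed_le hcN continuous_const))
    · refine (Metric.isBounded_closedBall (x := 0) (r := R)).subset ?_
      rintro ⟨x, s⟩ ⟨-, -, h⟩
      simp only at h
      rw [mem_closedBall_zero_iff, Prod.norm_mk, max_le_iff]
      refine ⟨abs_le_of_sq_le_sq' (by nlinarith [sq_nonneg s]) hR.le |>.2, ?_⟩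
      exact abs_le_of_sq_le_sq (by nlinarith [sq_nonneg ‖x‖]) hR.le
  · apply Continuous.continuousOn
    fun_prop
  · rintro ⟨x, s⟩ ⟨hx, hs, hR2⟩
    simp only at hx hs hR2 ⊢
    have hsR : s ≤ R := abs_le_of_sq_le_sq' (by nlinarith [sq_nonneg ‖x‖]) hR.le |>.2
    have hB : 0 ≤ (2 * (n : ℝ) + 1) * (s * (R - s)) :=
      mul_nonneg (by positivity) (mul_nonneg hs (by linarith))
    have hpos : 0 ≤ ‖x‖ ^ 2 + s ^ 2 - (2 * n + 1) * s ^ 2 + (2 * n + 1) * R * s := by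
      nlinarith [sq_nonneg s, sq_nonneg ‖x‖]
    rcases hx.eq_or_lt with hx0 | hx0
    · left
      rw [hH.eq_zero _ (by simp [hx0, hj.symm]), hH.eq_zero _ (by simp [hx0, hj.symm])]
      nlinarith [mul_nonneg hM.le hpos]
    rcases hs.eq_or_lt with rfl | hs0
    · left
      simp only [zero_smul, add_zero, sub_zero, sub_self, zero_sub, neg_nonpos]
      exact mul_nonneg hM.le hpos
    rcases hR2.eq_or_lt with hRe | hRl
    · left
      have h1 := (le_abs_self _).trans (hH.bound (x + s • e j))
      have h2 := (neg_le_abs _).trans (hH.bound (x - s • e j))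
      have hse : ‖s • e j‖ = s := by simp [he, norm_smul, abs_of_pos hs0]
      have h3 : ‖x + s • e j‖ ≤ 2 * R := by
        refine (norm_add_le _ _).trans ?_
        have : ‖x‖ ≤ R := abs_le_of_sq_le_sq' (by nlinarith [sq_nonneg s]) hR.le |>.2
        linarith
      have h4 : ‖x - s • e j‖ ≤ 2 * R := by
        refine (norm_sub_le _ _).trans ?_
        have : ‖x‖ ≤ R := abs_le_of_sq_le_sq' (by nlinarith [sq_nonneg s]) hR.le |>.2
        linarith
      have h5 := mul_le_mul_of_nonneg_left h3 hC.le
      have h6 := mul_le_mul_of_nonneg_left h4 hC.le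
      have h7 : M * R ^ 2 = 4 * C * R := by rw [hMdef]; field_simp
      have h8 : M * R ^ 2 ≤
          M * (‖x‖ ^ 2 + s ^ 2 - (2 * n + 1) * s ^ 2 + (2 * n + 1) * R * s) := by
        apply mul_le_mul_of_nonneg_left _ hM.le
        nlinarith
      linarith
    right
    constructor
    · have ho : IsOpen {p : EuclideanSpace ℝ (Fin n) × ℝ |
          p.1 0 < 0 ∧ 0 < p.2 ∧ ‖p.1‖ ^ 2 + p.2 ^ 2 < R ^ 2} :=
        (isOpen_lt (hcoord.comp continuous_fst) continuous_const).inter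
        ((isOpen_lt continuous_const continuous_snd).inter
          (isOpen_lt hcN continuous_const))
      filter_upwards [ho.mem_nhds ⟨hx0, hs0, hRl⟩] with p hp
      exact ⟨hp.1.le, hp.2.1.le, hp.2.2.le⟩
    obtain ⟨c, hc, hcs⟩ := hH.harmonic (x + s • e j) (by simpa [hej] using hx0)
    obtain ⟨d, hd, hds⟩ := hH.harmonic (x - s • e j) (by simpa [hej] using hx0)
    -- Weights 1 on (e_i, 0) for i ≠ j and 1/4 on (e_j, ±1) recover the difference of the two
    -- Laplacians, which is 0. The barrier contributes 2(n - 1) + (2 - k) = -1 times M, so some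
    -- direction must have a positive second derivative.
    by_contra! hcon
    have key : ∀ i, i ≠ j → c i - d i ≤ 2 * M := fun i _ => by
      have := hcon (e i, 0) _ (((hc i).symm_diff (hd i)).sub
        ((hasLineDeriv2_cylinder_barrier (2 * n + 1) R x s i 0).const_mul M))
      linarith
    have keyp := hcon (e j, 1) _ ((hc j).symm_diff_left.sub
        ((hasLineDeriv2_cylinder_barrier (2 * n + 1) R x s j 1).const_mul M))
    have keym := hcon (e j, -1) _ ((hd j).symm_diff_right.sub
        ((hasLineDeriv2_cylinder_barrier (2 * n + 1) R x s j (-1)).const_mul M))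
    have hsum : ∑ i, (c i - d i) = 0 := by rw [Finset.sum_sub_distrib, hcs, hds, sub_self]
    rw [← Finset.add_sum_erase _ _ (Finset.mem_univ j)] at hsum
    have hle : ∑ i ∈ Finset.univ.erase j, (c i - d i) ≤ (n - 1) * (2 * M) := by
      have := Finset.sum_le_card_nsmul (Finset.univ.erase j) (fun i => c i - d i) (2 * M)
        (fun i hi => key i (Finset.ne_of_mem_erase hi))
      rw [Finset.card_erase_of_mem (Finset.mem_univ j), Finset.card_univ, Fintype.card_fin,
        nsmul_eq_mul, Nat.cast_sub (NeZero.one_le)] at this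
      simpa using this
    nlinarith

/-- Lipschitz estimate in the directions parallel to the boundary. -/
theorem sub_le (hH : IsHalfSpaceHarmonic H C) (hC : 0 < C) {j : Fin n} (hj : j ≠ 0)
    {x : EuclideanSpace ℝ (Fin n)} (hx : x 0 ≤ 0) {s : ℝ} (hs : 0 ≤ s) :
    H (x + s • EuclideanSpace.single j 1) - H (x - s • EuclideanSpace.single j 1)
      ≤ 4 * C * (2 * n + 1) * s := by
  -- As R → ∞ only the barrier term linear in R survives the factor 4C/R.
  have ht : Filter.Tendsto (fun R : ℝ => 4 * C * (‖x‖ ^ 2 + s ^ 2 - (2 * n + 1) * s ^ 2) * R⁻¹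
      + 4 * C * (2 * n + 1) * s) Filter.atTop (nhds (4 * C * (2 * n + 1) * s)) := by
    simpa using (tendsto_inv_atTop_zero.const_mul
      (4 * C * (‖x‖ ^ 2 + s ^ 2 - (2 * n + 1) * s ^ 2))).add_const (4 * C * (2 * n + 1) * s)
  refine ge_of_tendsto ht ?_
  filter_upwards [Filter.eventually_ge_atTop (‖x‖ + s), Filter.eventually_gt_atTop 0] with R h1 h2
  have := hH.sub_le_on_ball hC hj h2 (x, s)
    ⟨hx, hs, by nlinarith [norm_nonneg x, mul_nonneg (norm_nonneg x) hs]⟩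
  simp only at this
  rw [sub_nonpos] at this
  refine this.trans (le_of_eq ?_)
  field_simp

/-- The step s is now frozen. The barrier |x|² - (n + 1) x₁(x₁ + R) is at least |x|² since -R ≤ x₁ ≤
0, so on the sphere its multiple dominates the bound of `sub_le`. -/
theorem sub_le_on_half_ball (hH : IsHalfSpaceHarmonic H C) (hC : 0 < C) {j : Fin n} (hj : j ≠ 0)
    {s : ℝ} (hs : 0 < s) {R : ℝ} (hR : 0 < R) :
    ∀ x ∈ {x : EuclideanSpace ℝ (Fin n) | x 0 ≤ 0 ∧ ‖x‖ ^ 2 ≤ R ^ 2},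
      H (x + s • EuclideanSpace.single j 1) - H (x - s • EuclideanSpace.single j 1)
        - 4 * C * (2 * n + 1) * s / R ^ 2 * (‖x‖ ^ 2 - (n + 1) * x 0 ^ 2 - (n + 1) * R * x 0)
        ≤ 0 := by
  have hM : 0 < 4 * C * (2 * n + 1) * s / R ^ 2 := by positivity
  have hMR : 4 * C * (2 * n + 1) * s / R ^ 2 * R ^ 2 = 4 * C * (2 * n + 1) * s := by field_simp
  set M := 4 * C * (2 * n + 1) * s / R ^ 2 with hMdef
  set e : Fin n → EuclideanSpace ℝ (Fin n) := fun i => EuclideanSpace.single i 1 with he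
  have hcH := hH.continuous
  have hcoord : Continuous fun x : EuclideanSpace ℝ (Fin n) => x 0 := by fun_prop
  have hcN : Continuous fun x : EuclideanSpace ℝ (Fin n) => ‖x‖ ^ 2 := by fun_prop
  have hej : e j 0 = 0 := by simp [he, hj.symm]
  apply nonpos_of_hasLineDeriv2_pos
  · apply Metric.isCompact_of_isClosed_isBounded
    · exact (isClosed_le hcoord continuous_const).inter
        (isClosed_le hcN continuous_const)
    · refine (Metric.isBounded_closedBall (x := 0) (r := R)).subset ?_
      rintro x ⟨-, h⟩
      rw [mem_closedBall_zero_iff]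
      exact abs_le_of_sq_le_sq' h hR.le |>.2
  · apply Continuous.continuousOn
    fun_prop
  · rintro x ⟨hx, hR2⟩
    have hx2 : x 0 ^ 2 ≤ ‖x‖ ^ 2 := by
      simpa using pow_le_pow_left₀ (norm_nonneg _) (PiLp.norm_apply_le x 0) 2
    have hxR : -R ≤ x 0 := (abs_le_of_sq_le_sq' (hx2.trans hR2) hR.le).1
    have hB : 0 ≤ ((n : ℝ) + 1) * (-x 0 * (R + x 0)) :=
      mul_nonneg (by positivity) (mul_nonneg (by linarith) (by linarith))
    have hB' : ‖x‖ ^ 2 ≤ ‖x‖ ^ 2 - (n + 1) * x 0 ^ 2 - (n + 1) * R * x 0 := by linarith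
    rcases hx.eq_or_lt with hx0 | hx0
    · left
      rw [hH.eq_zero _ (by simp [hx0, hj.symm]), hH.eq_zero _ (by simp [hx0, hj.symm])]
      nlinarith [mul_nonneg hM.le ((sq_nonneg ‖x‖).trans hB')]
    rcases hR2.eq_or_lt with hRe | hRl
    · left
      have h1 := hH.sub_le hC hj hx hs.le
      have h2 := mul_le_mul_of_nonneg_left hB' hM.le
      rw [hRe, hMR] at h2
      rw [hRe]
      linarith
    right
    constructor
    · have ho : IsOpen {x : EuclideanSpace ℝ (Fin n) | x 0 < 0 ∧ ‖x‖ ^ 2 < R ^ 2} :=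
        (isOpen_lt hcoord continuous_const).inter (isOpen_lt hcN continuous_const)
      filter_upwards [ho.mem_nhds ⟨hx0, hRl⟩] with p hp
      exact ⟨hp.1.le, hp.2.le⟩
    obtain ⟨c, hc, hcs⟩ := hH.harmonic (x + s • e j) (by simpa [hej] using hx0)
    obtain ⟨d, hd, hds⟩ := hH.harmonic (x - s • e j) (by simpa [hej] using hx0)
    have hbar : ∀ i : Fin n, HasLineDeriv2
        (fun x : EuclideanSpace ℝ (Fin n) => ‖x‖ ^ 2 - (n + 1) * x 0 ^ 2 - (n + 1) * R * x 0)
        x (e i) (2 * (1 - (n + 1) * if i = 0 then 1 else 0)) := fun i => by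
      have h0 : e i 0 = if i = 0 then 1 else 0 := by
        simp [he, eq_comm]
      apply HasLineDeriv2.of_quadratic
        (b := 2 * x i - (n + 1) * (2 * x 0 * e i 0) - (n + 1) * R * e i 0)
      intro t
      have := norm_sq_add_smul_single x i t
      simp only [PiLp.add_apply, PiLp.smul_apply, smul_eq_mul]
      rw [show e i = EuclideanSpace.single i 1 from rfl] at h0 ⊢
      rw [this, h0]
      split_ifs <;> ring
    -- Summing over all axes, the barrier has Laplacian 2n - 2(n + 1) = -2, whereas the difference
    -- of values of H has Laplacian 0.
    by_contra! hcon
    have key : ∀ i, c i - d i ≤ M * (2 * (1 - (n + 1) * if i = 0 then 1 else 0)) := fun i => by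
      have := hcon (e i) _ ((((hc i).comp_line
        (u := x) (w := e i) (φ := fun p => p + s • e j) 1 (fun t => by
          simp [he]; abel)).sub ((hd i).comp_line
        (u := x) (w := e i) (φ := fun p => p - s • e j) 1 (fun t => by
          simp [he]; abel))).sub ((hbar i).const_mul M))
      linarith
    have hsum := Finset.sum_le_sum fun i (_ : i ∈ Finset.univ) => key i
    rw [Finset.sum_sub_distrib, hcs, hds, ← Finset.mul_sum, ← Finset.mul_sum,
      Finset.sum_sub_distrib, ← Finset.mul_sum] at hsum
    simp at hsum
    nlinarith

/-- At a fixed point the barrier grows like R while its coefficient decays like R⁻², so the bound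
tends to 0. -/
theorem sub_nonpos (hH : IsHalfSpaceHarmonic H C) (hC : 0 < C) {j : Fin n} (hj : j ≠ 0)
    {x : EuclideanSpace ℝ (Fin n)} (hx : x 0 ≤ 0) {s : ℝ} (hs : 0 < s) :
    H (x + s • EuclideanSpace.single j 1) - H (x - s • EuclideanSpace.single j 1) ≤ 0 := by
  obtain ⟨D, hD⟩ : ∃ D, D = 4 * C * (2 * n + 1) * s := ⟨_, rfl⟩
  have ht : Filter.Tendsto (fun R : ℝ => D * (‖x‖ ^ 2 - (n + 1) * x 0 ^ 2) * (R⁻¹ * R⁻¹)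
      - D * (n + 1) * x 0 * R⁻¹) Filter.atTop (nhds 0) := by
    have hi := tendsto_inv_atTop_zero (𝕜 := ℝ)
    simpa using ((hi.mul hi).const_mul (D * (‖x‖ ^ 2 - (n + 1) * x 0 ^ 2))).sub
      (hi.const_mul (D * (n + 1) * x 0))
  refine ge_of_tendsto ht ?_
  filter_upwards [Filter.eventually_ge_atTop ‖x‖, Filter.eventually_gt_atTop 0] with R h1 h2
  have := hH.sub_le_on_half_ball hC hj hs h2 x ⟨hx, by nlinarith [norm_nonneg x]⟩
  rw [_root_.sub_nonpos, ← hD] at this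
  refine this.trans (le_of_eq ?_)
  field_simp

theorem add_single (hH : IsHalfSpaceHarmonic H C) (hC : 0 < C) {j : Fin n} (hj : j ≠ 0)
    {x : EuclideanSpace ℝ (Fin n)} (hx : x 0 ≤ 0) (s : ℝ) :
    H (x + s • EuclideanSpace.single j 1) = H x := by
  have key : ∀ y : EuclideanSpace ℝ (Fin n), y 0 ≤ 0 → ∀ s : ℝ, 0 < s →
      H (y + s • EuclideanSpace.single j 1) = H (y - s • EuclideanSpace.single j 1) := by
    intro y hy s hs
    have h1 := hH.sub_nonpos hC hj hy hs
    have h2 := hH.neg.sub_nonpos hC hj hy hs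
    linarith
  have hm : ∀ r : ℝ, (x + r • EuclideanSpace.single j (1 : ℝ)) 0 ≤ 0 := fun r => by
    simpa [hj.symm] using hx
  rcases lt_trichotomy s 0 with h | rfl | h
  · have := key _ (hm (s / 2)) (-s / 2) (by linarith)
    convert this.symm using 2 <;> module
  · simp
  · have := key _ (hm (s / 2)) (s / 2) (by linarith)
    convert this using 2 <;> module

theorem eq_apply_single (hH : IsHalfSpaceHarmonic H C) (hC : 0 < C)
    {x : EuclideanSpace ℝ (Fin n)} (hx : x 0 ≤ 0) :
    H x = H (x 0 • EuclideanSpace.single 0 1) := by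
  have key : ∀ S : Finset (Fin n), 0 ∉ S →
      H (x 0 • EuclideanSpace.single 0 1 + ∑ i ∈ S, x i • EuclideanSpace.single i 1)
        = H (x 0 • EuclideanSpace.single 0 1) := by
    intro S
    induction S using Finset.induction_on with
    | empty => simp
    | insert j S hjS ih =>
      intro h0
      rw [Finset.mem_insert, not_or] at h0
      rw [Finset.sum_insert hjS, add_comm (x j • _), ← add_assoc,
        hH.add_single hC (Ne.symm h0.1), ih h0.2]
      simp only [PiLp.add_apply, PiLp.smul_apply, WithLp.ofLp_sum, Finset.sum_apply]
      rw [Finset.sum_eq_zero fun i hi => by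
        simp [show (0 : Fin n) ≠ i from fun h => h0.2 (h ▸ hi)]]
      simpa using hx
  have := key (Finset.univ.erase 0) (by simp)
  rw [Finset.add_sum_erase Finset.univ (fun i => x i • EuclideanSpace.single i (1 : ℝ))
    (Finset.mem_univ 0)] at this
  rw [← this]
  congr 1
  have := (EuclideanSpace.basisFun (Fin n) ℝ).sum_repr x
  simpa using this.symm

/-- A Liouville theorem in the half-space. -/
theorem exists_eq_mul (hH : IsHalfSpaceHarmonic H C) (hC : 0 < C) :
    ∃ a : ℝ, ∀ x, x 0 < 0 → H x = a * x 0 := by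
  set e : EuclideanSpace ℝ (Fin n) := EuclideanSpace.single 0 1 with he
  set F : ℝ → ℝ := fun t => H (t • e) with hF
  have hd : ∀ t : ℝ, t < 0 → HasLineDeriv2 H (t • e) e 0 := by
    intro t ht
    obtain ⟨c, hc, hs⟩ := hH.harmonic (t • e) (by simpa [he] using ht)
    -- Tangential invariance removes every second derivative but the normal one, which harmonicity
    -- then forces to be 0.
    have h0 : ∀ j, j ≠ 0 → c j = 0 := fun j hj => by
      refine (hc j).unique ?_
      simpa using HasLineDeriv2.of_quadratic (f := H) (x := t • e)
        (v := EuclideanSpace.single j 1) (a := 0) (b := 0) (fun r => by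
          simpa using hH.add_single hC hj (by simpa [he] using ht.le) r)
    rw [Finset.sum_eq_single 0 (fun j _ hj => h0 j hj) (by simp)] at hs
    simpa [hs] using hc 0
  have hd' : ∀ t : ℝ, t < 0 → ∃ g : ℝ → ℝ, (∀ᶠ r in nhds t, HasDerivAt F (g r) r) ∧ HasDerivAt g 0 t := by
    intro t ht
    obtain ⟨g, hg, hg0⟩ := hd t ht
    have hl : ∀ r : ℝ, HasDerivAt (fun r : ℝ => r - t) 1 r := fun r => (hasDerivAt_id r).sub_const t
    refine ⟨fun r => g (r - t), ?_, ?_⟩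
    · have : Filter.Tendsto (fun r : ℝ => r - t) (nhds t) (nhds 0) := by
        simpa using (hl t).continuousAt.tendsto
      filter_upwards [this.eventually hg] with r hr
      have := HasDerivAt.comp r hr (hl r)
      rw [mul_one] at this
      refine this.congr_of_eventuallyEq (.of_forall fun q => ?_)
      simp only [hF, Function.comp]
      congr 1
      module
    · have h0 : HasDerivAt g 0 (t - t) := by simpa using hg0
      exact (HasDerivAt.comp t (h := fun r => r - t) h0 (hl t)).congr_deriv (by simp)
  have hF1 : ∀ t < 0, HasDerivAt F (deriv F t) t := fun t ht => by
    obtain ⟨g, hg, -⟩ := hd' t ht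
    exact hg.self_of_nhds.differentiableAt.hasDerivAt
  have hF2 : ∀ t < 0, HasDerivAt (deriv F) 0 t := fun t ht => by
    obtain ⟨g, hg, h0⟩ := hd' t ht
    exact h0.congr_of_eventuallyEq (hg.mono fun r hr => hr.deriv)
  have hconst : ∀ t < 0, deriv F t = deriv F (-1) := fun t ht =>
    isOpen_Iio.is_const_of_deriv_eq_zero (convex_Iio (0 : ℝ)).isPreconnected
      (fun r hr => (hF2 r hr).differentiableAt.differentiableWithinAt)
      (fun r hr => (hF2 r hr).deriv) ht (by norm_num : (-1 : ℝ) ∈ Set.Iio 0)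
  set a := deriv F (-1) with ha
  have hG : ∀ t < 0, HasDerivAt (fun t => F t - a * t) 0 t := fun t ht => by
    have := (hF1 t ht).sub ((hasDerivAt_id t).const_mul a)
    exact this.congr_deriv (by rw [hconst t ht]; simp)
  have hG' : ∀ t < 0, F t - a * t = F (-1) - a * (-1) := fun t ht =>
    isOpen_Iio.is_const_of_deriv_eq_zero (convex_Iio (0 : ℝ)).isPreconnected
      (fun r hr => (hG r hr).differentiableAt.differentiableWithinAt)
      (fun r hr => (hG r hr).deriv) ht (by norm_num : (-1 : ℝ) ∈ Set.Iio 0)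
  -- The constant of integration vanishes: let t → 0⁻ and use H(0) = 0.
  have hlim : F (-1) - a * (-1) = 0 := by
    have hc : Continuous fun t => F t - a * t := by
      have := hH.continuous
      fun_prop
    have h1 := (hc.tendsto 0).mono_left (nhdsWithin_le_nhds (s := Set.Iio 0))
    have h2 : F 0 - a * 0 = 0 := by simp [hF, hH.eq_zero 0 (by simp)]
    rw [h2] at h1
    refine tendsto_nhds_unique (tendsto_const_nhds.congr' ?_) h1
    filter_upwards [self_mem_nhdsWithin] with t ht using (hG' t ht).symm
  refine ⟨a, fun x hx => ?_⟩
  rw [hH.eq_apply_single hC hx.le]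
  have := hG' _ hx
  rw [hlim] at this
  linarith

end IsHalfSpaceHarmonic
-- The Kelvin transform and harmonicity
open Laplacian in
theorem InnerProductSpace.HarmonicAt.sum_fderiv_fderiv {n : ℕ} {h : EuclideanSpace ℝ (Fin n) → ℝ}
    {x : EuclideanSpace ℝ (Fin n)} (hh : InnerProductSpace.HarmonicAt h x) :
    ∑ i, fderiv ℝ (fderiv ℝ h) x (EuclideanSpace.single i 1) (EuclideanSpace.single i 1) = 0 := by
  have h1 : Δ h x = 0 := hh.2.self_of_nhds
  rw [InnerProductSpace.laplacian_eq_iteratedFDeriv_orthonormalBasis h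
    (EuclideanSpace.basisFun (Fin n) ℝ)] at h1
  simpa [iteratedFDeriv_two_apply] using h1

section
variable {E : Type*} [NormedAddCommGroup E] [InnerProductSpace ℝ E]

theorem hasDerivAt_inner_line (x v : E) (t : ℝ) :
    HasDerivAt (fun t : ℝ => inner ℝ (x + t • v) v) (‖v‖ ^ 2) t := by
  have : (fun t : ℝ => inner ℝ (x + t • v) v) = fun t => inner ℝ x v + t * ‖v‖ ^ 2 := by
    funext t
    rw [inner_add_left, inner_smul_left, real_inner_self_eq_norm_sq]
    simp
  rw [this]
  exact (((hasDerivAt_id t).mul_const (‖v‖ ^ 2)).const_add _).congr_deriv (by simp)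

theorem hasDerivAt_line (x v : E) (t : ℝ) : HasDerivAt (fun t : ℝ => x + t • v) v t := by
  simpa using ((hasDerivAt_id t).smul_const v).const_add x

theorem hasDerivAt_norm_zpow_line (m : ℤ) (x v : E) (t : ℝ) (hx : x + t • v ≠ 0) :
    HasDerivAt (fun t : ℝ => ‖x + t • v‖ ^ m)
      (m * ‖x + t • v‖ ^ (m - 2) * inner ℝ (x + t • v) v) t := by
  have hN : ‖x + t • v‖ ≠ 0 := norm_ne_zero_iff.2 hx
  have h1 : HasDerivAt (fun t : ℝ => ‖x + t • v‖) (inner ℝ (x + t • v) v / ‖x + t • v‖) t := by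
    have h2 := ((hasDerivAt_line x v t).norm_sq).sqrt (by positivity)
    simp only [Real.sqrt_sq (norm_nonneg _)] at h2
    refine h2.congr_deriv ?_
    field_simp
  have h3 := HasDerivAt.comp t (h₂ := fun r : ℝ => r ^ m) (hasDerivAt_zpow m _ (Or.inl hN)) h1
  refine h3.congr_deriv ?_
  rw [show m - 2 = m - 1 - 1 by ring, zpow_sub_one₀ hN (m - 1)]
  field_simp

/-- The Kelvin transform of `h`, with the power of the norm as a parameter. -/
theorem hasLineDeriv2_kelvin {h : E → ℝ} (m : ℤ) {x : E} (hx : x ≠ 0) (v : E)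
    (hh : ContDiffAt ℝ 2 h (‖x‖ ^ (-2 : ℤ) • x)) :
    HasLineDeriv2 (fun y => ‖y‖ ^ m * h (‖y‖ ^ (-2 : ℤ) • y)) x v
      (let N := ‖x‖; let p := inner ℝ x v; let z := ‖x‖ ^ (-2 : ℤ) • x
       let D := fderiv ℝ h z; let D2 := fderiv ℝ (fderiv ℝ h) z
       (m * (m - 2) * N ^ (m - 4) * p ^ 2 + m * N ^ (m - 2) * ‖v‖ ^ 2) * h z
       + 2 * (m * N ^ (m - 2) * p) * (-2 * N ^ (-4 : ℤ) * p * D x + N ^ (-2 : ℤ) * D v)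
       + N ^ m * (4 * N ^ (-8 : ℤ) * p ^ 2 * D2 x x - 2 * N ^ (-6 : ℤ) * p * D2 v x
          - 2 * N ^ (-6 : ℤ) * p * D2 x v + N ^ (-4 : ℤ) * D2 v v
          + (8 * N ^ (-6 : ℤ) * p ^ 2 - 2 * N ^ (-4 : ℤ) * ‖v‖ ^ 2) * D x
          - 4 * N ^ (-4 : ℤ) * p * D v)) := by
  have hx0 : x + (0 : ℝ) • v ≠ 0 := by simpa using hx
  have hne : ∀ᶠ t : ℝ in nhds 0, x + t • v ≠ 0 :=
    (HasLineDeriv2.tendsto_line x v).eventually_ne hx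
  -- The inversion x ↦ x/|x|² along the line, followed by its velocity.
  set φ : ℝ → E := fun t => ‖x + t • v‖ ^ (-2 : ℤ) • (x + t • v) with hφ
  set φ' : ℝ → E := fun t =>
    (-2 * ‖x + t • v‖ ^ (-4 : ℤ) * inner ℝ (x + t • v) v) • (x + t • v)
      + ‖x + t • v‖ ^ (-2 : ℤ) • v with hφ'
  have hdφ : ∀ t : ℝ, x + t • v ≠ 0 → HasDerivAt φ (φ' t) t := fun t ht => by
    have := (hasDerivAt_norm_zpow_line (-2) x v t ht).smul (hasDerivAt_line x v t)
    refine this.congr_deriv ?_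
    simp only [hφ']
    norm_num
    abel
  have hdφ' : HasDerivAt φ' ((8 * ‖x‖ ^ (-6 : ℤ) * inner ℝ x v ^ 2
      - 2 * ‖x‖ ^ (-4 : ℤ) * ‖v‖ ^ 2) • x - (4 * ‖x‖ ^ (-4 : ℤ) * inner ℝ x v) • v) 0 := by
    have h4 := (hasDerivAt_norm_zpow_line (-4) x v 0 hx0).const_mul (-2)
    have h2 := hasDerivAt_norm_zpow_line (-2) x v 0 hx0
    have := ((h4.mul (hasDerivAt_inner_line x v 0)).smul (hasDerivAt_line x v 0)).add
      (h2.smul_const v)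
    refine this.congr_deriv ?_
    norm_num
    module
  have hφ0 : φ 0 = ‖x‖ ^ (-2 : ℤ) • x := by simp [hφ]
  have hφ'0 : φ' 0 = (-2 * ‖x‖ ^ (-4 : ℤ) * inner ℝ x v) • x + ‖x‖ ^ (-2 : ℤ) • v := by
    simp [hφ']
  rw [← hφ0] at hh
  have hh1 : ∀ᶠ t in nhds (0 : ℝ), DifferentiableAt ℝ h (φ t) := by
    have h1 : ∀ᶠ y in nhds (φ 0), ContDiffAt ℝ 2 h y := hh.eventually (by simp)
    have := (hdφ 0 hx0).continuousAt.tendsto.eventually h1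
    exact this.mono fun t ht => ht.differentiableAt (by simp)
  have hh2 : DifferentiableAt ℝ (fderiv ℝ h) (φ 0) :=
    (hh.fderiv_right (m := 1) (by norm_num)).differentiableAt (by simp)
  have hdh : HasDerivAt (fun t => h (φ t)) (fderiv ℝ h (φ 0) (φ' 0)) 0 :=
    hh1.self_of_nhds.hasFDerivAt.comp_hasDerivAt 0 (hdφ 0 hx0)
  have hdD : HasDerivAt (fun t => fderiv ℝ h (φ t)) (fderiv ℝ (fderiv ℝ h) (φ 0) (φ' 0)) 0 :=
    hh2.hasFDerivAt.comp_hasDerivAt 0 (hdφ 0 hx0)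
  refine ⟨fun t => m * ‖x + t • v‖ ^ (m - 2) * inner ℝ (x + t • v) v * h (φ t)
    + ‖x + t • v‖ ^ m * fderiv ℝ h (φ t) (φ' t), ?_, ?_⟩
  · filter_upwards [hne, hh1] with t ht hht
    exact (hasDerivAt_norm_zpow_line m x v t ht).mul
      (hht.hasFDerivAt.comp_hasDerivAt t (hdφ t ht))
  · have hm := hasDerivAt_norm_zpow_line m x v 0 hx0
    have hm2 := ((hasDerivAt_norm_zpow_line (m - 2) x v 0 hx0).const_mul (m : ℝ)).mul
      (hasDerivAt_inner_line x v 0)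
    have := (hm2.mul hdh).add (hm.mul (hdD.clm_apply hdφ'))
    refine this.congr_deriv ?_
    simp only [zero_smul, add_zero, hφ0, hφ'0, map_add, map_sub, map_smul,
      _root_.add_apply, _root_.smul_apply, smul_eq_mul, Pi.mul_apply]
    rw [show m - 2 - 2 = m - 4 by ring]
    push_cast
    have hN : ‖x‖ ≠ 0 := norm_ne_zero_iff.2 hx
    rw [show (-8 : ℤ) = -4 + -4 by norm_num, show (-6 : ℤ) = -4 + -2 by norm_num,
      zpow_add₀ hN, zpow_add₀ hN, show (-4 : ℤ) = -2 + -2 by norm_num, zpow_add₀ hN]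
    ring

end

theorem EuclideanSpace.sum_mul_map_single {n : ℕ} {F : Type*} [NormedAddCommGroup F]
    [NormedSpace ℝ F] (L : EuclideanSpace ℝ (Fin n) →L[ℝ] F) (x : EuclideanSpace ℝ (Fin n)) :
    ∑ i, x i • L (EuclideanSpace.single i 1) = L x := by
  have := (EuclideanSpace.basisFun (Fin n) ℝ).sum_repr x
  conv_rhs => rw [← this]
  simp

/-- The Kelvin transform preserves harmonicity. -/
theorem exists_sum_eq_zero_kelvin {n : ℕ} {h : EuclideanSpace ℝ (Fin n) → ℝ}
    {x : EuclideanSpace ℝ (Fin n)} (hx : x ≠ 0)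
    (hh : InnerProductSpace.HarmonicAt h (‖x‖ ^ (-2 : ℤ) • x)) :
    ∃ c : Fin n → ℝ, (∀ i, HasLineDeriv2
      (fun y => ‖y‖ ^ (2 - (n : ℤ)) * h (‖y‖ ^ (-2 : ℤ) • y)) x
        (EuclideanSpace.single i 1) (c i)) ∧ ∑ i, c i = 0 := by
  refine ⟨_, fun i => hasLineDeriv2_kelvin (2 - n) hx _ hh.1, ?_⟩
  have hs := hh.sum_fderiv_fderiv
  simp only [EuclideanSpace.inner_single_right, PiLp.norm_single]
  set z := ‖x‖ ^ (-2 : ℤ) • x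
  set D := fderiv ℝ h z
  set D2 := fderiv ℝ (fderiv ℝ h) z
  have s1 : ∑ i, x i ^ 2 = ‖x‖ ^ 2 := by simp [EuclideanSpace.norm_sq_eq]
  have s2 := EuclideanSpace.sum_mul_map_single D x
  have s3 := EuclideanSpace.sum_mul_map_single (D2 x) x
  have s4 := congrArg (fun L => L x) (EuclideanSpace.sum_mul_map_single D2 x)
  simp only [_root_.sum_apply, _root_.smul_apply] at s4
  simp only [smul_eq_mul] at s2 s3 s4
  have hN : ‖x‖ ≠ 0 := norm_ne_zero_iff.2 hx
  set N := ‖x‖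
  have e4 : N ^ (2 - (n : ℤ) - 4) = N ^ (2 - (n : ℤ)) * N ^ (-2 : ℤ) * N ^ (-2 : ℤ) := by
    rw [← zpow_add₀ hN, ← zpow_add₀ hN]; ring_nf
  have e2 : N ^ (2 - (n : ℤ) - 2) = N ^ (2 - (n : ℤ)) * N ^ (-2 : ℤ) := by
    rw [← zpow_add₀ hN]; ring_nf
  have f4 : N ^ (-4 : ℤ) = (N ^ (-2 : ℤ)) ^ 2 := by rw [← zpow_natCast, ← zpow_mul]; rfl
  have f6 : N ^ (-6 : ℤ) = (N ^ (-2 : ℤ)) ^ 3 := by rw [← zpow_natCast, ← zpow_mul]; rfl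
  have f8 : N ^ (-8 : ℤ) = (N ^ (-2 : ℤ)) ^ 4 := by rw [← zpow_natCast, ← zpow_mul]; rfl
  have hNQ : N ^ 2 * N ^ (-2 : ℤ) = 1 := by
    rw [← zpow_natCast, ← zpow_add₀ hN]; simp
  rw [f4, f6, f8, e4, e2]
  generalize N ^ (2 - (n : ℤ)) = P at *
  generalize N ^ (-2 : ℤ) = Q at *
  set m : ℝ := ((2 - (n : ℤ) : ℤ) : ℝ) with hm
  have hm' : m = 2 - n := by simp [hm]
  calc _ = ∑ i, ((m * (m - 2) * P * Q ^ 2 * h z - 4 * m * P * Q ^ 3 * D x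
          + P * (4 * Q ^ 4 * D2 x x + 8 * Q ^ 3 * D x)) * x i ^ 2
        + (m * P * Q * h z - 2 * P * Q ^ 2 * D x)
        + (2 * m * P * Q ^ 2 - 4 * P * Q ^ 2) * (x i * D (EuclideanSpace.single i 1))
        + (-2 * P * Q ^ 3) * (x i * D2 x (EuclideanSpace.single i 1))
        + (-2 * P * Q ^ 3) * (x i * D2 (EuclideanSpace.single i 1) x)
        + P * Q ^ 2 * D2 (EuclideanSpace.single i 1) (EuclideanSpace.single i 1)) := by
        refine Finset.sum_congr rfl fun i _ => ?_
        simp only [norm_one, one_mul, conj_trivial]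
        ring
    _ = 0 := by
        simp only [Finset.sum_add_distrib, ← Finset.mul_sum, s1, s2, s3, s4, hs,
          Finset.sum_const, Finset.card_univ, Fintype.card_fin, nsmul_eq_mul]
        rw [hm']
        -- Once |x|² Q = 1 is used, the coefficient of h(z) is proportional to m(m - 2 + n) and that
        -- of D x to 4 - 2n - 2m; both vanish for m = 2 - n. The D² x x terms cancel for every m.
        linear_combination ((2 - n) * (-n) * P * Q * h z - 4 * (2 - n) * P * Q ^ 2 * D x
          + P * (4 * Q ^ 3 * D2 x x + 8 * Q ^ 2 * D x)) * hNQ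

/-! ### The extended Kelvin transform satisfies the Liouville hypotheses -/

/-- The Kelvin transform of `h` in the half-space, extended by zero. -/
noncomputable def halfSpaceKelvin {n : ℕ} [NeZero n] (h : EuclideanSpace ℝ (Fin n) → ℝ)
    (x : EuclideanSpace ℝ (Fin n)) : ℝ :=
  open scoped Classical in
  if x 0 < 0 then ‖x‖ ^ (2 - (n : ℤ)) * h (‖x‖ ^ (-2 : ℤ) • x) else 0

theorem zpow_norm_smul_mem_negHalfSpace {n : ℕ} [NeZero n] {x : EuclideanSpace ℝ (Fin n)}
    (hx : x 0 < 0) : ‖x‖ ^ (-2 : ℤ) • x ∈ negHalfSpace n := by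
  have hx0 : x ≠ 0 := by rintro rfl; simp at hx
  have : 0 < ‖x‖ ^ (-2 : ℤ) := zpow_pos (norm_pos_iff.2 hx0) _
  simpa [negHalfSpace] using mul_neg_of_pos_of_neg this hx

theorem isOpen_negHalfSpace (n : ℕ) [NeZero n] : IsOpen (negHalfSpace n) :=
  isOpen_lt (by fun_prop) continuous_const

theorem mem_closure_negHalfSpace {n : ℕ} [NeZero n] {x : EuclideanSpace ℝ (Fin n)} :
    x ∈ closure (negHalfSpace n) ↔ x 0 ≤ 0 := by
  constructor
  · intro hx
    have hc : IsClosed {x : EuclideanSpace ℝ (Fin n) | x 0 ≤ 0} :=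
      isClosed_le (by fun_prop) continuous_const
    have hsub : negHalfSpace n ⊆ {x | x 0 ≤ 0} := by
      intro y hy
      exact show y 0 ≤ 0 from le_of_lt (show y 0 < 0 from hy)
    exact closure_minimal hsub hc hx
  · intro hx
    have ht := (HasLineDeriv2.tendsto_line x (EuclideanSpace.single 0 (-1 : ℝ))).mono_left
      (nhdsWithin_le_nhds (s := Set.Ioi 0))
    refine mem_closure_of_tendsto ht ?_
    filter_upwards [self_mem_nhdsWithin] with t ht
    have : 0 < t := ht
    simp [negHalfSpace]
    linarith

theorem mem_frontier_negHalfSpace {n : ℕ} [NeZero n] {x : EuclideanSpace ℝ (Fin n)} :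
    x ∈ frontier (negHalfSpace n) ↔ x 0 = 0 := by
  rw [(isOpen_negHalfSpace n).frontier_eq, Set.mem_sdiff, mem_closure_negHalfSpace]
  simp only [negHalfSpace, Set.mem_ofPred_eq, not_lt]
  exact le_antisymm_iff.symm

section
variable {n : ℕ} [NeZero n] {h : EuclideanSpace ℝ (Fin n) → ℝ} {C : ℝ}

theorem abs_halfSpaceKelvin_le (hC : 0 < C)
    (h_bound : ∀ x ∈ negHalfSpace n, |h x| ≤ C * ‖x‖ ^ (1 - (n : ℤ)))
    (x : EuclideanSpace ℝ (Fin n)) : |halfSpaceKelvin h x| ≤ C * ‖x‖ := by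
  unfold halfSpaceKelvin
  split_ifs with hx
  · have hx0 : x ≠ 0 := by rintro rfl; simp at hx
    have hN : ‖x‖ ≠ 0 := norm_ne_zero_iff.2 hx0
    have h1 := h_bound _ (zpow_norm_smul_mem_negHalfSpace hx)
    have h2 : ‖‖x‖ ^ (-2 : ℤ) • x‖ = ‖x‖ ^ (-1 : ℤ) := by
      rw [norm_smul, norm_zpow, norm_norm, ← zpow_add_one₀ hN]; norm_num
    rw [h2, ← zpow_mul] at h1
    rw [abs_mul, abs_zpow, abs_norm]
    refine (mul_le_mul_of_nonneg_left h1 (by positivity)).trans (le_of_eq ?_)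
    rw [mul_left_comm, ← zpow_add₀ hN]
    rw [show 2 - (n : ℤ) + -1 * (1 - n) = 1 by ring, zpow_one]
  · simp only [abs_zero]; positivity

/-- At 0 the linear bound gives continuity; at other boundary points the formula and the zero
extension agree, since inversion preserves the hyperplane, and the two closed sides are glued. -/
theorem continuous_halfSpaceKelvin (hC : 0 < C)
    (h_cont : ContinuousOn h (closure (negHalfSpace n) \ {0}))
    (h_boundary : ∀ x ∈ frontier (negHalfSpace n) \ {0}, h x = 0)
    (h_bound : ∀ x ∈ negHalfSpace n, |h x| ≤ C * ‖x‖ ^ (1 - (n : ℤ))) :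
    Continuous (halfSpaceKelvin h) := by
  have hK : ∀ x : EuclideanSpace ℝ (Fin n), x 0 ≤ 0 → x ≠ 0 →
      ‖x‖ ^ (-2 : ℤ) • x ∈ closure (negHalfSpace n) \ {0} := fun x hx hx0 => by
    have : 0 < ‖x‖ ^ (-2 : ℤ) := zpow_pos (norm_pos_iff.2 hx0) _
    refine ⟨mem_closure_negHalfSpace.2 ?_, ?_⟩
    · simpa using mul_nonpos_of_nonneg_of_nonpos this.le hx
    · exact smul_ne_zero this.ne' hx0
  have hg : ContinuousOn (fun x => ‖x‖ ^ (2 - (n : ℤ)) * h (‖x‖ ^ (-2 : ℤ) • x))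
      (closure (negHalfSpace n) \ {0}) := by
    have hz : ∀ m : ℤ, ContinuousOn (fun x : EuclideanSpace ℝ (Fin n) => ‖x‖ ^ m)
        (closure (negHalfSpace n) \ {0}) := fun m =>
      continuous_norm.continuousOn.zpow₀ m fun x hx => Or.inl (norm_ne_zero_iff.2 hx.2)
    refine (hz _).mul (h_cont.comp ((hz _).smul continuousOn_id) fun x hx => ?_)
    exact hK x (mem_closure_negHalfSpace.1 hx.1) hx.2
  rw [continuous_iff_continuousAt]
  intro x
  by_cases hx0 : x = 0
  · subst hx0
    have h0 : halfSpaceKelvin h 0 = 0 := by simp [halfSpaceKelvin]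
    rw [ContinuousAt, h0]
    refine squeeze_zero_norm (abs_halfSpaceKelvin_le hC h_bound) ?_
    have : Continuous fun x : EuclideanSpace ℝ (Fin n) => C * ‖x‖ := by fun_prop
    simpa using this.tendsto 0
  have hle : ContinuousWithinAt (halfSpaceKelvin h) {y | 0 ≤ y 0} x ∨ x 0 < 0 := by
    rcases lt_or_ge (x 0) 0 with hx | hx
    · exact Or.inr hx
    · left
      refine (continuousWithinAt_const (b := (0 : ℝ))).congr (fun y (hy : 0 ≤ y 0) => ?_) ?_
      · simp [halfSpaceKelvin, not_lt.2 hy]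
      · simp [halfSpaceKelvin, not_lt.2 hx]
  rcases lt_trichotomy (x 0) 0 with hx | hx | hx
  · have hn : negHalfSpace n \ {0} ∈ nhds x :=
      ((isOpen_negHalfSpace n).sdiff isClosed_singleton).mem_nhds ⟨hx, hx0⟩
    have h1 := (hg.mono (Set.sdiff_subset_sdiff_left subset_closure)).continuousAt hn
    refine h1.congr ?_
    filter_upwards [hn] with y hy
    simp [halfSpaceKelvin, show y 0 < 0 from hy.1]
  · have hx' : x ∈ closure (negHalfSpace n) \ {0} := ⟨mem_closure_negHalfSpace.2 hx.le, hx0⟩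
    have hfr : ‖x‖ ^ (-2 : ℤ) • x ∈ frontier (negHalfSpace n) \ {0} :=
      ⟨mem_frontier_negHalfSpace.2 (by simp [hx]), (hK x hx.le hx0).2⟩
    have h1 : ContinuousWithinAt (halfSpaceKelvin h) (closure (negHalfSpace n) \ {0}) x := by
      have hval : ∀ y ∈ closure (negHalfSpace n) \ {0},
          halfSpaceKelvin h y = ‖y‖ ^ (2 - (n : ℤ)) * h (‖y‖ ^ (-2 : ℤ) • y) := fun y hy => by
        rcases (mem_closure_negHalfSpace.1 hy.1).lt_or_eq with hy' | hy'
        · simp [halfSpaceKelvin, hy']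
        · rw [h_boundary _ ⟨mem_frontier_negHalfSpace.2 (by simp [hy']),
            (hK y hy'.le hy.2).2⟩]
          simp [halfSpaceKelvin, hy']
      exact (hg x hx').congr hval (hval x hx')
    have h2 := hle.resolve_right (by simp [hx])
    refine (h1.union h2).continuousAt ?_
    filter_upwards [isOpen_ne.mem_nhds hx0] with y hy
    rcases le_total (y 0) 0 with h | h
    · exact Or.inl ⟨mem_closure_negHalfSpace.2 h, hy⟩
    · exact Or.inr h
  · refine (hle.resolve_right (by simp [hx.le])).continuousAt ?_
    have ho : IsOpen {y : EuclideanSpace ℝ (Fin n) | 0 < y 0} :=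
      isOpen_lt continuous_const (by fun_prop)
    filter_upwards [ho.mem_nhds hx] with y hy using le_of_lt hy

theorem isHalfSpaceHarmonic_halfSpaceKelvin (hC : 0 < C)
    (h_cont : ContinuousOn h (closure (negHalfSpace n) \ {0}))
    (h_harmonic : InnerProductSpace.HarmonicOnNhd h (negHalfSpace n))
    (h_boundary : ∀ x ∈ frontier (negHalfSpace n) \ {0}, h x = 0)
    (h_bound : ∀ x ∈ negHalfSpace n, |h x| ≤ C * ‖x‖ ^ (1 - (n : ℤ))) :
    IsHalfSpaceHarmonic (halfSpaceKelvin h) C where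
  continuous := continuous_halfSpaceKelvin hC h_cont h_boundary h_bound
  eq_zero x hx := by simp [halfSpaceKelvin, not_lt.2 hx]
  bound := abs_halfSpaceKelvin_le hC h_bound
  harmonic x hx := by
    have hx0 : x ≠ 0 := by rintro rfl; simp at hx
    obtain ⟨c, hc, hs⟩ := exists_sum_eq_zero_kelvin hx0
      (h_harmonic _ (zpow_norm_smul_mem_negHalfSpace hx))
    refine ⟨c, fun i => (hc i).congr ?_, hs⟩
    filter_upwards [(isOpen_negHalfSpace n).mem_nhds hx] with y hy
    simp [halfSpaceKelvin, show y 0 < 0 from hy]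

/-- The Kelvin transform is an involution: inversion is, and the powers of |x| cancel. -/
theorem eq_norm_zpow_mul_halfSpaceKelvin {x : EuclideanSpace ℝ (Fin n)} (hx : x 0 < 0) :
    h x = ‖x‖ ^ (2 - (n : ℤ)) * halfSpaceKelvin h (‖x‖ ^ (-2 : ℤ) • x) := by
  have hx0 : x ≠ 0 := by rintro rfl; simp at hx
  have hN : ‖x‖ ≠ 0 := norm_ne_zero_iff.2 hx0
  have h1 : (‖x‖ ^ (-2 : ℤ) • x) 0 < 0 := zpow_norm_smul_mem_negHalfSpace hx
  have h2 : ‖‖x‖ ^ (-2 : ℤ) • x‖ = ‖x‖ ^ (-1 : ℤ) := by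
    rw [norm_smul, norm_zpow, norm_norm, ← zpow_add_one₀ hN]; norm_num
  rw [halfSpaceKelvin, if_pos h1, h2, smul_smul, ← zpow_mul, ← zpow_mul, ← mul_assoc,
    ← zpow_add₀ hN, ← zpow_add₀ hN]
  rw [show 2 - (n : ℤ) + -1 * (2 - n) = 0 by ring]
  norm_num

end

/-! ### Return to h and the sign of the constant -/

theorem mainTheorem11 (n : ℕ) [NeZero n] (h : EuclideanSpace ℝ (Fin n) → ℝ)
    (h_C2 : ContDiffOn ℝ 2 h (closure (negHalfSpace n) \ {0}))
    (h_nonneg : ∀ᶠ x in nhdsWithin 0 (closure (negHalfSpace n) \ {0}), 0 ≤ h x)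
    (h_harmonic : InnerProductSpace.HarmonicOnNhd h (negHalfSpace n))
    (h_boundary : ∀ x ∈ frontier (negHalfSpace n) \ {0}, h x = 0)
    (h_bound : ∃ C : ℝ, 0 < C ∧ ∀ x ∈ negHalfSpace n, |h x| ≤ C * ‖x‖ ^ (1 - (n : ℤ))) :
    ∃ α : ℝ, 0 ≤ α ∧
      ∀ x ∈ closure (negHalfSpace n) \ {0}, h x = α * (|x 0| / ‖x‖ ^ n) := by
  obtain ⟨C, hC, hb⟩ := h_bound
  obtain ⟨a, ha⟩ := (isHalfSpaceHarmonic_halfSpaceKelvin hC h_C2.continuousOn h_harmonic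
    h_boundary hb).exists_eq_mul hC
  have key : ∀ x ∈ closure (negHalfSpace n) \ {0}, h x = -a * (|x 0| / ‖x‖ ^ n) := by
    intro x hx
    have hN : ‖x‖ ≠ 0 := norm_ne_zero_iff.2 hx.2
    rcases (mem_closure_negHalfSpace.1 hx.1).lt_or_eq with hx' | hx'
    · rw [eq_norm_zpow_mul_halfSpaceKelvin (h := h) hx', ha _ (zpow_norm_smul_mem_negHalfSpace hx'),
        abs_of_neg hx', zpow_sub₀ hN, PiLp.smul_apply, smul_eq_mul, zpow_neg, zpow_natCast]
      field_simp
    · rw [h_boundary x ⟨mem_frontier_negHalfSpace.2 hx', hx.2⟩, hx']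
      simp
  refine ⟨-a, ?_, key⟩
  -- The sign is read off along the inner normal -t e₁, t → 0⁺, where |x₁| > 0.
  have ht : Filter.Tendsto (fun t : ℝ => (0 : EuclideanSpace ℝ (Fin n))
      + t • EuclideanSpace.single 0 (-1 : ℝ)) (nhdsWithin 0 (Set.Ioi 0))
      (nhdsWithin 0 (closure (negHalfSpace n) \ {0})) := by
    refine tendsto_nhdsWithin_iff.2
      ⟨(HasLineDeriv2.tendsto_line 0 _).mono_left nhdsWithin_le_nhds, ?_⟩
    filter_upwards [self_mem_nhdsWithin] with t ht
    have ht : 0 < t := ht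
    exact ⟨mem_closure_negHalfSpace.2 (by simpa using ht.le), by simp [ht.ne']⟩
  obtain ⟨t, ⟨h1, h2⟩, h3 : 0 < t⟩ := (((ht.eventually h_nonneg).and
    (ht.eventually self_mem_nhdsWithin)).and self_mem_nhdsWithin).exists
  rw [key _ h2] at h1
  refine nonneg_of_mul_nonneg_left h1 (div_pos (abs_pos.2 ?_) (pow_pos (norm_pos_iff.2 h2.2) _))
  simp [h3.ne']
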